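/- A topological space $X$ is called selectively sequentially pseudocompact if for every sequence $(U_n)_{n\in\mathbb N}$ of non-empty open subsets of $X$ one can choose points $x_n\in U_n$ ($n\in\mathbb N$) such that the sequence $(x_n)$ has a subsequence converging to a point of $X$. A cardinal $\tau$ is called selectively admissible if either $\tau$ is finite or there is an infinite cardinal $\sigma$ with $\sigma^{\omega}=\sigma\le\tau\le 2^{\sigma}$. Let $\mathbb T=\mathbb R/\mathbb Z$ be the circle group. Theorem (in ZFC). Let $\tau\ge\omega$ be a selectively admissible cardinal, and let $F_\tau$ be the free Abelian group of rank $\tau$. Then $F_\tau$ admits a Hausdorff group topology that is connected, locally connected and selectively sequentially pseudocompact. Moreover, for every infinite cardinal $\sigma$ with $\sigma^{\omega}=\sigma\le\tau\le 2^{\sigma}$, there is such a topology on $F_\tau$ for which $F_\tau$ is isomorphic, as a topological group, to a dense subgroup of $\mathbb T^{\sigma}$ with the product topology. -/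

import Mathlib

open Filter Topology Cardinal

universe u

/-- A cardinal `τ` is selectively admissible if it is finite, or if `σ ^ ω = σ ≤ τ ≤ 2 ^ σ` for some
infinite cardinal `σ`. -/
def SelectivelyAdmissible (τ : Cardinal.{u}) : Prop :=
  τ < ℵ₀ ∨ ∃ σ : Cardinal.{u}, ℵ₀ ≤ σ ∧ σ ^ (ℵ₀ : Cardinal.{u}) = σ ∧ σ ≤ τ ∧ τ ≤ 2 ^ σ

/-- A topological space is selectively sequentially pseudocompact if from every sequence of non-empty
open sets one can choose points `x n ∈ U n` such that the sequence `x` has a convergent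
subsequence. -/
def SelSeqPseudocompact (Y : Type*) [TopologicalSpace Y] : Prop :=
  ∀ U : ℕ → Set Y, (∀ n, IsOpen (U n)) → (∀ n, (U n).Nonempty) →
    ∃ x : ℕ → Y, (∀ n, x n ∈ U n) ∧
      ∃ φ : ℕ → ℕ, StrictMono φ ∧ ∃ a : Y, Tendsto (x ∘ φ) atTop (𝓝 a)

/-!
Let `σ = #S` and `𝕋 = UnitAddCircle`. The free group on `B` is realised as a subgroup `G` of `𝕋 ^ S`
such that every countable set `I ⊆ S` admits a continuous map `L` from `𝕋 ^ I` into `𝕋 ^ S` which has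
its values in `G` and satisfies `L z = z` on `I` (`HasContinuousSections`). All the topological
properties follow from such sections:

* `G` is dense, since basic open sets depend on finitely many coordinates;
* the trace on `G` of a box with connected sides and finite support is connected
  (`HasContinuousSections.isPreconnected_pi_inter`), so `G` is connected and locally connected;
* given open sets `U n`, the coordinates on which boxes inside them depend form a countable set `I`.
  Points of these boxes, restricted to `I`, have a convergent subsequence in the compact metrizable
  space `𝕋 ^ I`, and `L` carries it into `G` (`HasContinuousSections.selSeqPseudocompact`).

To build `G`, let `b ∈ B` enumerate all sequences `i b : ℕ → S`, and take for each `b` and each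
`k ∈ 𝕋 ^ ℕ` a generator which has the values `k` along `i b`. At the remaining coordinates its values
depend continuously on `k` and are chosen to make the whole family independent: each coordinate
carries a label describing a finite test that can isolate one pair `(b, k)` among finitely many, and
each label occurs uncountably often, so that some occurrence avoids the countably many coordinates
prescribed for the generators in a given linear combination (`lift_generator_injective`). The hypotheses
`σ ^ ω = σ ≤ τ ≤ 2 ^ σ` are what the counting in `exists_embedding` needs.
-/

/-! ### Subsets of a power with continuous sections over countable sets -/

section Sections

variable {S X Y : Type*} [TopologicalSpace X]

/-- `D ⊆ X ^ S` has continuous sections over countable sets if every countable set of coordinates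
lies in the range of a sequence `i` such that every assignment of values along `i` extends to an
element of `D`, in a way that depends continuously on these values. Repetitions in `i` are
allowed, so only the assignments of the form `y ∘ i` are to be extended. -/
def HasContinuousSections (D : Set (S → X)) : Prop :=
  ∀ I : Set S, I.Countable → ∃ i : ℕ → S, I ⊆ Set.range i ∧
    ∃ L : (ℕ → X) → S → X, Continuous L ∧ Set.range L ⊆ D ∧ ∀ y n, L (y ∘ i) (i n) = y (i n)

namespace HasContinuousSections

variable {D : Set (S → X)}

theorem exists_retraction (hD : HasContinuousSections D) {I : Set S} (hI : I.Countable) :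
    ∃ R : (S → X) → S → X, Continuous R ∧ (∀ y, R y ∈ D) ∧ ∀ y, ∀ s ∈ I, R y s = y s := by
  obtain ⟨i, hi, L, hL, hLD, hLi⟩ := hD I hI
  refine ⟨fun y ↦ L (y ∘ i), hL.comp (by fun_prop), fun y ↦ hLD ⟨_, rfl⟩, fun y s hs ↦ ?_⟩
  obtain ⟨n, rfl⟩ := hi hs
  exact hLi y n

theorem dense (hD : HasContinuousSections D) : Dense D := by
  refine dense_iff_inter_open.2 fun U hU ⟨y, hy⟩ ↦ ?_
  obtain ⟨J, u, hu, hJ⟩ := isOpen_pi_iff.1 hU y hy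
  obtain ⟨R, -, hRD, hR⟩ := hD.exists_retraction J.countable_toSet
  exact ⟨R y, hJ fun s hs ↦ by rw [hR y s hs]; exact (hu s hs).2, hRD y⟩

/-- A set `D` with continuous sections meets every finitely supported box with connected sides in a
connected set: if two open sets meet this trace, then a continuous map which retracts the box into
`D` without changing the finitely many coordinates involved has an image that meets both of
them. -/
theorem isPreconnected_pi_inter (hD : HasContinuousSections D) (J : Finset S) (W : S → Set X)
    (hW : ∀ s, IsOpen (W s)) (hWc : ∀ s, IsPreconnected (W s))
    (hX : IsPreconnected (Set.univ : Set X)) :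
    IsPreconnected ((J : Set S).pi W ∩ D) := by
  classical
  have hV : IsPreconnected ((J : Set S).pi W) := by
    rw [show (J : Set S).pi W = Set.univ.pi fun s ↦ if s ∈ J then W s else Set.univ by
      ext y
      simp only [Set.mem_pi, Finset.mem_coe, Set.mem_univ, true_implies]
      refine forall_congr' fun s ↦ ?_
      by_cases hs : s ∈ J <;> simp [hs]]
    refine isPreconnected_univ_pi fun s ↦ ?_
    split_ifs
    exacts [hWc s, hX]
  have hVo : IsOpen ((J : Set S).pi W) := isOpen_set_pi J.finite_toSet fun s _ ↦ hW s
  rintro u v hu hv huv ⟨y, ⟨hyV, -⟩, hyu⟩ ⟨z, ⟨hzV, -⟩, hzv⟩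
  obtain ⟨Ju, U, hU, hUs⟩ := isOpen_pi_iff.1 hu y hyu
  obtain ⟨Jv, V, hV', hVs⟩ := isOpen_pi_iff.1 hv z hzv
  obtain ⟨R, hRc, hRD, hR⟩ := hD.exists_retraction (J ∪ Ju ∪ Jv).countable_toSet
  have hR' : ∀ x ∈ (J : Set S).pi W, R x ∈ (J : Set S).pi W ∩ D := fun x hx ↦
    ⟨fun s hs ↦ by
      rw [hR x s (by simp [Finset.mem_coe.1 hs])]; exact hx s hs, hRD x⟩
  obtain ⟨_, ⟨x, hx, rfl⟩, hxuv⟩ := hV.image R hRc.continuousOn u v hu hv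
    (by rintro _ ⟨x, hx, rfl⟩; exact huv (hR' x hx))
    ⟨R y, ⟨y, hyV, rfl⟩, hUs fun s hs ↦ by
      rw [hR y s (by simp [Finset.mem_coe.1 hs])]; exact (hU s hs).2⟩
    ⟨R z, ⟨z, hzV, rfl⟩, hVs fun s hs ↦ by
      rw [hR z s (by simp [Finset.mem_coe.1 hs])]; exact (hV' s hs).2⟩
  exact ⟨R x, hR' x hx, hxuv⟩

variable [TopologicalSpace Y] {f : Y → S → X}

theorem preconnectedSpace [PreconnectedSpace X] (hf : IsInducing f)
    (hD : HasContinuousSections (Set.range f)) : PreconnectedSpace Y := by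
  refine ⟨hf.isPreconnected_image.1 ?_⟩
  have := hD.isPreconnected_pi_inter ∅ (fun _ ↦ Set.univ) (fun _ ↦ isOpen_univ)
    (fun _ ↦ isPreconnected_univ) isPreconnected_univ
  simpa using this

theorem locallyConnectedSpace [PreconnectedSpace X] [LocallyConnectedSpace X] (hf : IsInducing f)
    (hD : HasContinuousSections (Set.range f)) : LocallyConnectedSpace Y := by
  refine locallyConnectedSpace_iff_connected_subsets.2 fun y U hU ↦ ?_
  obtain ⟨V, hV, hVU⟩ := (hf.nhds_eq_comap y ▸ hU : U ∈ comap f (𝓝 (f y)))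
  obtain ⟨V', hV'V, hV'o, hyV'⟩ := mem_nhds_iff.1 hV
  obtain ⟨J, u, hu, hJ⟩ := isOpen_pi_iff.1 hV'o _ hyV'
  have hW : ∀ s, ∃ W : Set X, IsOpen W ∧ IsPreconnected W ∧ f y s ∈ W ∧ (s ∈ J → W ⊆ u s) := by
    intro s
    by_cases hs : s ∈ J
    · obtain ⟨W, hWu, hWo, hyW, hWc⟩ := locallyConnectedSpace_iff_subsets_isOpen_isConnected.1
        ‹_› (f y s) (u s) ((hu s hs).1.mem_nhds (hu s hs).2)
      exact ⟨W, hWo, hWc.isPreconnected, hyW, fun _ ↦ hWu⟩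
    · exact ⟨Set.univ, isOpen_univ, isPreconnected_univ, trivial, fun h ↦ (hs h).elim⟩
  choose W hWo hWc hyW hWu using hW
  refine ⟨f ⁻¹' (J : Set S).pi W, ?_, hf.isPreconnected_image.1 ?_, ?_⟩
  · exact ((isOpen_set_pi J.finite_toSet fun s _ ↦ hWo s).preimage hf.continuous).mem_nhds
      fun s _ ↦ hyW s
  · rw [Set.image_preimage_eq_inter_range]
    exact hD.isPreconnected_pi_inter J W hWo hWc isPreconnected_univ
  · exact fun x hx ↦ hVU (hV'V (hJ fun s hs ↦ hWu s hs (hx s hs)))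

/-- The supports of countably many basic open sets form one countable set, and the section over
it transports convergent subsequences from the sequentially compact space `X ^ ℕ`. -/
theorem selSeqPseudocompact [CompactSpace X] [FirstCountableTopology X] (hf : IsInducing f)
    (hD : HasContinuousSections (Set.range f)) : SelSeqPseudocompact Y := by
  intro U hU hne
  choose y hy using hne
  have hbox : ∀ n, ∃ (J : Finset S) (u : S → Set X), (∀ s ∈ J, f (y n) s ∈ u s) ∧
      f ⁻¹' (J : Set S).pi u ⊆ U n := by
    intro n
    obtain ⟨V, hV, hVU⟩ := hf.isOpen_iff.1 (hU n)
    obtain ⟨J, u, hu, hJ⟩ := isOpen_pi_iff.1 hV (f (y n)) (hVU.ge (hy n))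
    exact ⟨J, u, fun s hs ↦ (hu s hs).2, hVU ▸ Set.preimage_mono hJ⟩
  choose J u hu hJ using hbox
  obtain ⟨i, hi, L, hL, hLD, hLi⟩ := hD (⋃ n, (J n : Set S))
    (Set.countable_iUnion fun n ↦ (J n).countable_toSet)
  choose g hg using fun k ↦ hLD ⟨k, rfl⟩
  obtain ⟨k, φ, hφ, hk⟩ := CompactSpace.tendsto_subseq fun n ↦ f (y n) ∘ i
  refine ⟨fun n ↦ g (f (y n) ∘ i), fun n ↦ hJ n fun s hs ↦ ?_, φ, hφ, g k, ?_⟩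
  · obtain ⟨m, rfl⟩ := hi (Set.mem_iUnion.2 ⟨n, hs⟩)
    rw [hg, hLi]
    exact hu n _ hs
  · rw [hf.tendsto_nhds_iff, hg]
    convert (hL.tendsto k).comp hk using 1
    funext n
    exact hg _

end HasContinuousSections

end Sections

/-! ### A free family in a power of the circle -/

section Generators

variable {B S : Type*}

/-- The value at a coordinate labelled `c = (F, P, E, r)` of the generator with indices `A` and `k`:
zero unless the label has the trace of `A` on `F` equal to that of `P`, and then the class of the
real number `r * ∏ k' ∈ E, d k k'`. The first two entries of the label thus separate finitely many
sets `A`, and the third separates finitely many points `k`. -/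
noncomputable def labelValue {K : Type*} (d : K → K → ℝ) (A : Set S)
    (c : Finset S × Finset S × Finset K × ℝ) (k : K) : UnitAddCircle :=
  open Classical in
  if ∀ s ∈ c.1, s ∈ A ↔ s ∈ c.2.1 then ((c.2.2.2 * ∏ k' ∈ c.2.2.1, d k k' : ℝ) : UnitAddCircle)
  else 0

/-- The generator with indices `i`, `A` and `k`: it takes the values `k` along the sequence `i` of
coordinates and is given by the labels `p` of the coordinates elsewhere. If `i` takes a value
several times, one of the entries of `k` is chosen. -/
noncomputable def generator (d : (ℕ → UnitAddCircle) → (ℕ → UnitAddCircle) → ℝ)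
    (p : S → Finset S × Finset S × Finset (ℕ → UnitAddCircle) × ℝ) (i : ℕ → S) (A : Set S)
    (k : ℕ → UnitAddCircle) (s : S) : UnitAddCircle :=
  open Classical in
  if s ∈ Set.range i then k (Function.invFun i s) else labelValue d A (p s) k

variable {d : (ℕ → UnitAddCircle) → (ℕ → UnitAddCircle) → ℝ}
  {p : S → Finset S × Finset S × Finset (ℕ → UnitAddCircle) × ℝ}

theorem continuous_generator (hd : ∀ k', Continuous fun k ↦ d k k') (i : ℕ → S) (A : Set S) :
    Continuous (generator d p i A) := by
  refine continuous_pi fun s ↦ ?_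
  unfold generator labelValue
  split_ifs
  · fun_prop
  · exact (AddCircle.continuous_mk' 1).comp
      (continuous_const.mul (continuous_finsetProd _ fun k' _ ↦ hd k'))
  · fun_prop

theorem generator_comp_apply (i : ℕ → S) (A : Set S) (y : S → UnitAddCircle) (n : ℕ) :
    generator d p i A (y ∘ i) (i n) = y (i n) := by
  have : i (Function.invFun i (i n)) = i n := Function.invFun_eq ⟨n, rfl⟩
  simp [generator, this]

/-- For a pair `q`, finitely many other pairs and a nonzero integer `m`, some label gives the value
zero to all of these other pairs, while the `m`-th multiple of its value at `q` is nonzero. -/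
theorem exists_labelValue {K : Type*} {d : K → K → ℝ} (hd : ∀ k k', d k k' = 0 ↔ k = k')
    {A : B → Set S} (hA : Function.Injective A) (Q : Finset (B × K)) (q : B × K) {m : ℤ}
    (hm : m ≠ 0) :
    ∃ c, m • labelValue d (A q.1) c q.2 ≠ 0 ∧
      ∀ q' ∈ Q, q' ≠ q → labelValue d (A q'.1) c q'.2 = 0 := by
  classical
  have hsep : ∀ b, ∃ F : Finset S, b ≠ q.1 → ∃ s ∈ F, ¬(s ∈ A b ↔ s ∈ A q.1) := by
    intro b
    by_cases hb : b = q.1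
    · exact ⟨∅, fun h ↦ (h hb).elim⟩
    · obtain ⟨s, hs⟩ : ∃ s, ¬(s ∈ A b ↔ s ∈ A q.1) := by
        by_contra! h
        exact hb (hA (Set.ext h))
      exact ⟨{s}, fun _ ↦ ⟨s, by simp, hs⟩⟩
  choose F hF using hsep
  set F' : Finset S := Q.biUnion fun q' ↦ F q'.1
  set E : Finset K := (Q.image Prod.snd).erase q.2
  have hE : ∏ k' ∈ E, d q.2 k' ≠ 0 :=
    Finset.prod_ne_zero_iff.2 fun k' hk' h ↦ (Finset.mem_erase.1 hk').1 ((hd _ _).1 h).symm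
  -- With this value of `r`, the `m`-th multiple of the surviving value is the class of `1 / 2`.
  refine ⟨(F', F'.filter (· ∈ A q.1), E, (2 * m * ∏ k' ∈ E, d q.2 k')⁻¹), ?_, ?_⟩
  · have hm' : (m : ℝ) ≠ 0 := Int.cast_ne_zero.2 hm
    rw [labelValue, if_pos (by simp +contextual), ← AddCircle.coe_zsmul, Ne,
      AddCircle.coe_eq_zero_iff]
    rintro ⟨n, hn⟩
    have h2 : (m : ℝ) * ((2 * m * ∏ k' ∈ E, d q.2 k')⁻¹ * ∏ k' ∈ E, d q.2 k') = 1 / 2 := by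
      field_simp
    rw [zsmul_eq_mul, zsmul_eq_mul, h2, mul_one] at hn
    have : (2 * n : ℤ) = 1 := by
      have : (2 * n : ℝ) = 1 := by rw [hn]; norm_num
      exact_mod_cast this
    omega
  · intro q' hq' hne
    by_cases hb : q'.1 = q.1
    · have hk : q'.2 ≠ q.2 := fun h ↦ hne (Prod.ext hb h)
      have h0 : ∏ k' ∈ E, d q'.2 k' = 0 := Finset.prod_eq_zero
        (Finset.mem_erase.2 ⟨hk, Finset.mem_image_of_mem _ hq'⟩) ((hd _ _).2 rfl)
      simp [labelValue, h0]
    · obtain ⟨s, hs, hsA⟩ := hF q'.1 hb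
      have hsF : s ∈ F' := Finset.mem_biUnion.2 ⟨q', hq', hs⟩
      rw [labelValue, if_neg]
      intro h
      exact hsA ((h s hsF).trans (by simp [hsF]))

/-- If every label occurs at uncountably many coordinates, the generators are free: a label that
isolates one term of a given combination also occurs outside the countably many coordinates at which
the generators involved take prescribed values. -/
theorem lift_generator_injective (hdz : ∀ k k', d k k' = 0 ↔ k = k')
    (hp : ∀ c, ¬(p ⁻¹' {c}).Countable) (i : B → ℕ → S) {A : B → Set S}
    (hA : Function.Injective A) :
    Function.Injective (FreeAbelianGroup.lift
      fun q : B × (ℕ → UnitAddCircle) ↦ generator d p (i q.1) (A q.1) q.2) := by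
  classical
  refine (injective_iff_map_eq_zero _).2 fun a ha ↦ ?_
  by_contra hne
  have hne' : FreeAbelianGroup.toFinsupp a ≠ 0 := fun h ↦
    hne ((FreeAbelianGroup.equivFinsupp _).map_eq_zero_iff.1 h)
  obtain ⟨q, hq⟩ := Finsupp.ne_iff.1 hne'
  set t := FreeAbelianGroup.toFinsupp a with ht
  obtain ⟨c, hc, hc'⟩ := exists_labelValue hdz hA t.support q hq
  have hctb : (⋃ q ∈ t.support, Set.range (i q.1)).Countable :=
    Set.Countable.biUnion t.support.countable_toSet fun q _ ↦ Set.countable_range _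
  obtain ⟨s, hs, hsN⟩ : ∃ s, p s = c ∧ s ∉ ⋃ q ∈ t.support, Set.range (i q.1) := by
    by_contra! h
    exact hp c (hctb.mono h)
  have hval : ∀ q' ∈ t.support, generator d p (i q'.1) (A q'.1) q'.2 s =
      labelValue d (A q'.1) c q'.2 := fun q' hq' ↦ by
    rw [generator, if_neg fun h ↦ hsN (Set.mem_biUnion hq' h), hs]
  rw [← Finsupp.toFreeAbelianGroup_toFinsupp a, ← ht] at ha
  have h0 := congrFun ha s
  rw [Finsupp.toFreeAbelianGroup, Finsupp.liftAddHom_apply, Finsupp.sum, map_sum,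
    Finset.sum_apply, Finset.sum_eq_single_of_mem q (Finsupp.mem_support_iff.2 hq)] at h0
  · simp [hval q (Finsupp.mem_support_iff.2 hq)] at h0
    exact hc h0
  · intro q' hq' hqq
    simp [hval q' hq', hc' q' hq' hqq]

end Generators

/-! ### The free group inside the power -/

/-- The generators are indexed by `B × (ℕ → 𝕋)`, which is as large as `B` because
`𝔠 ≤ #S ^ ℵ₀ = #S ≤ #B`. The sequences of coordinates can be enumerated by `B` since there are
`#S ^ ℵ₀ = #S` of them, and `#B ≤ 2 ^ #S` provides the pairwise distinct subsets of `S` by which the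
labels separate the elements of `B`. -/
theorem exists_embedding (B S : Type u) (hS : ℵ₀ ≤ #S) (hω : #S ^ (ℵ₀ : Cardinal.{u}) = #S)
    (hSB : #S ≤ #B) (hBS : #B ≤ 2 ^ #S) :
    ∃ f : FreeAbelianGroup B →+ (S → UnitAddCircle), Function.Injective f ∧
      HasContinuousSections (Set.range f) := by
  have : Infinite S := infinite_iff.2 hS
  have : Nonempty B := mk_ne_zero_iff.1 (aleph0_pos.trans_le (hS.trans hSB)).ne'
  have hcS : 𝔠 ≤ #S := by
    rw [← hω, ← two_power_aleph0]
    exact power_le_power_right ((natCast_le_aleph0 (n := 2)).trans hS)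
  have hcirc : #UnitAddCircle ≤ 𝔠 :=
    (mk_le_of_surjective (QuotientAddGroup.mk_surjective
      (s := AddSubgroup.zmultiples (1 : ℝ)))).trans mk_real.le
  have hK : #(ℕ → UnitAddCircle) ≤ 𝔠 := by
    rw [← power_def, mk_nat]
    exact (power_le_power_right hcirc).trans continuum_power_aleph0.le
  have hKf : #(Finset (ℕ → UnitAddCircle)) ≤ 𝔠 := by
    classical
    exact (mk_le_of_surjective List.toFinset_surjective).trans
      ((mk_list_le_max _).trans (max_le aleph0_le_continuum hK))
  have hKS : lift.{u} #(ℕ → UnitAddCircle) ≤ #S :=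
    (lift_le.2 hK).trans (by simpa using hcS)
  -- The coordinates are labelled so that every label occurs `#S > ℵ₀` times.
  have hlab : #((Finset S × Finset S × Finset (ℕ → UnitAddCircle) × ℝ) × S) = #S := by
    have h1 : lift.{u} #(Finset (ℕ → UnitAddCircle)) * lift.{u} #ℝ ≤ #S :=
      mul_le_of_le hS ((lift_le.2 hKf).trans (by simpa using hcS))
        ((lift_le.2 mk_real.le).trans (by simpa using hcS))
    refine le_antisymm ?_ (mk_le_of_surjective
      (Prod.snd_surjective (α := Finset S × Finset S × Finset (ℕ → UnitAddCircle) × ℝ)))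
    simp only [mk_prod, mk_finset_of_infinite, lift_id, lift_mul, lift_uzero]
    exact mul_le_of_le hS (mul_le_of_le hS le_rfl (mul_le_of_le hS le_rfl h1)) le_rfl
  obtain ⟨π⟩ := Cardinal.eq.1 hlab
  set p := fun s ↦ (π.symm s).1 with hp
  have hpc : ∀ c, ¬(p ⁻¹' {c}).Countable := by
    intro c hc
    have : (Set.range fun s : S ↦ π (c, s)).Countable :=
      hc.mono (by rintro _ ⟨s, rfl⟩; simp [hp])
    have hinj : Function.Injective fun s : S ↦ π (c, s) := fun s s' h ↦ by simpa using h
    rw [← le_aleph0_iff_set_countable, mk_range_eq _ hinj] at this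
    exact (aleph0_lt_continuum.trans_le hcS).not_ge this
  obtain ⟨i, hi⟩ : ∃ i : B → ℕ → S, Function.Surjective i := by
    have : #(ℕ → S) ≤ #B := by
      rw [mk_pi, prod_const]
      simpa [hω] using hSB
    obtain ⟨j⟩ := this
    exact ⟨Function.invFun j, Function.invFun_surjective j.injective⟩
  obtain ⟨A⟩ : #B ≤ #(Set S) := by rwa [mk_set]
  obtain ⟨ε⟩ : Nonempty (B ≃ B × (ℕ → UnitAddCircle)) := by
    refine Cardinal.eq.1 ?_
    rw [mk_prod, lift_uzero, mul_eq_left (hS.trans hSB) (hKS.trans hSB)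
      (lift_eq_zero.not.2 (mk_ne_zero _))]
  let _ := TopologicalSpace.metrizableSpaceMetric (ℕ → UnitAddCircle)
  refine ⟨(FreeAbelianGroup.lift fun q : B × (ℕ → UnitAddCircle) ↦
      generator dist p (i q.1) (A q.1) q.2).comp (FreeAbelianGroup.equivOfEquiv ε).toAddMonoidHom,
    (lift_generator_injective (fun _ _ ↦ dist_eq_zero) hpc i A.injective).comp
      (FreeAbelianGroup.equivOfEquiv ε).injective, fun I hI ↦ ?_⟩
  have hseq : ∃ j : ℕ → S, I ⊆ Set.range j := by
    obtain rfl | hne := I.eq_empty_or_nonempty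
    · exact ⟨fun _ ↦ Classical.arbitrary S, Set.empty_subset _⟩
    · obtain ⟨j, rfl⟩ := hI.exists_eq_range hne
      exact ⟨j, subset_rfl⟩
  obtain ⟨j, hj⟩ := hseq
  obtain ⟨b, rfl⟩ := hi j
  refine ⟨i b, hj, generator dist p (i b) (A b),
    continuous_generator (fun k' ↦ by fun_prop) _ _, ?_, generator_comp_apply _ _⟩
  rintro _ ⟨k, rfl⟩
  refine ⟨(FreeAbelianGroup.equivOfEquiv ε).symm (FreeAbelianGroup.of (b, k)), ?_⟩
  simp

theorem theorem3p12 (τ : Cardinal.{u}) (hτ : ℵ₀ ≤ τ) (hsa : SelectivelyAdmissible τ)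
    (B : Type u) (hB : #B = τ) :
    (∃ _ : TopologicalSpace (FreeAbelianGroup B),
      IsTopologicalAddGroup (FreeAbelianGroup B) ∧ T2Space (FreeAbelianGroup B) ∧
      ConnectedSpace (FreeAbelianGroup B) ∧ LocallyConnectedSpace (FreeAbelianGroup B) ∧
      SelSeqPseudocompact (FreeAbelianGroup B)) ∧
    ∀ S : Type u, ℵ₀ ≤ #S → #S ^ (ℵ₀ : Cardinal.{u}) = #S → #S ≤ τ → τ ≤ 2 ^ #S →
      ∃ _ : TopologicalSpace (FreeAbelianGroup B),
        IsTopologicalAddGroup (FreeAbelianGroup B) ∧ T2Space (FreeAbelianGroup B) ∧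
        ConnectedSpace (FreeAbelianGroup B) ∧ LocallyConnectedSpace (FreeAbelianGroup B) ∧
        SelSeqPseudocompact (FreeAbelianGroup B) ∧
        ∃ f : FreeAbelianGroup B →+ (S → UnitAddCircle), IsEmbedding f ∧ DenseRange f := by
  subst hB
  have main : ∀ S : Type u, ℵ₀ ≤ #S → #S ^ (ℵ₀ : Cardinal.{u}) = #S → #S ≤ #B → #B ≤ 2 ^ #S →
      ∃ _ : TopologicalSpace (FreeAbelianGroup B),
        IsTopologicalAddGroup (FreeAbelianGroup B) ∧ T2Space (FreeAbelianGroup B) ∧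
        ConnectedSpace (FreeAbelianGroup B) ∧ LocallyConnectedSpace (FreeAbelianGroup B) ∧
        SelSeqPseudocompact (FreeAbelianGroup B) ∧
        ∃ f : FreeAbelianGroup B →+ (S → UnitAddCircle), IsEmbedding f ∧ DenseRange f := by
    intro S hS hω hSB hBS
    obtain ⟨f, hf, hD⟩ := exists_embedding B S hS hω hSB hBS
    have : LocallyConnectedSpace UnitAddCircle :=
      (isQuotientMap_quotient_mk' (s := QuotientAddGroup.leftRel
        (AddSubgroup.zmultiples (1 : ℝ)))).isCoinducing.locallyConnectedSpace
    let _ : TopologicalSpace (FreeAbelianGroup B) := .induced f inferInstance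
    have hemb : IsEmbedding f := ⟨⟨rfl⟩, hf⟩
    have := hD.preconnectedSpace hemb.isInducing
    exact ⟨_, topologicalAddGroup_induced f, hemb.t2Space, ⟨inferInstance⟩,
      hD.locallyConnectedSpace hemb.isInducing, hD.selSeqPseudocompact hemb.isInducing, f, hemb,
      hD.dense⟩
  refine ⟨?_, main⟩
  obtain h | ⟨σ, hσ, hω, hστ, hτσ⟩ := hsa
  · exact (hτ.not_gt h).elim
  · obtain ⟨T, hG, h2, hc, hlc, hs, -⟩ := main σ.out (by simpa) (by simpa) (by simpa) (by simpa)
    exact ⟨T, hG, h2, hc, hlc, hs⟩
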